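/- Let $\mathcal H$ be a separable complex Hilbert space (of finite or infinite dimension), and let $L^1(\mathcal H)$ be the space of trace-class operators on $\mathcal H$, that is, of the bounded operators $A$ with $\|A\|_1=\operatorname{tr}|A|<\infty$, with the topology of the trace norm $\|\cdot\|_1$. Let $\rho\in L^1(\mathcal H)$ be Hermitian ($\rho^\dagger=\rho$), and let $\mathcal O_\rho=\{U\rho U^\dagger : U \text{ a unitary operator on } \mathcal H\}\subset L^1(\mathcal H)$ be its unitary coadjoint orbit. Then $\mathcal O_\rho$ is closed in $L^1(\mathcal H)$ if and only if $\rho$ has finite rank. -/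

import Mathlib

open scoped ENNReal InnerProductSpace

namespace CoadjointOrbit

section TraceNorm

variable {H : Type*} [NormedAddCommGroup H] [InnerProductSpace ℂ H]

/-- The trace `∑ i, ⟪b i, T (b i)⟫ ∈ [0, ∞]` of a positive semi-definite bounded operator `T`,
computed in the orthonormal (Hilbert) basis `b`. -/
noncomputable def traceAlong {ι : Type*} (b : HilbertBasis ι ℂ H) (T : H →L[ℂ] H) : ℝ≥0∞ :=
  ∑' i, ENNReal.ofReal (RCLike.re ⟪b i, T (b i)⟫_ℂ)

lemma ofReal_norm_sq_eq_tsum {ι : Type*} (b : HilbertBasis ι ℂ H) (x : H) :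
    ENNReal.ofReal (‖x‖ ^ 2) = ∑' i, ENNReal.ofReal (‖⟪b i, x⟫_ℂ‖ ^ 2) := by
  have h := b.hasSum_inner_mul_inner x x
  have h2 : HasSum (fun i => ‖⟪b i, x⟫_ℂ‖ ^ 2) (‖x‖ ^ 2) := by
    have h3 := Complex.hasSum_re h
    convert h3 using 1
    · funext i
      rw [← inner_conj_symm x (b i), RCLike.conj_mul]
      norm_cast
    · exact (inner_self_eq_norm_sq (𝕜 := ℂ) x).symm
  rw [← h2.tsum_eq, ENNReal.ofReal_tsum_of_nonneg (fun _ => by positivity) h2.summable]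

variable [CompleteSpace H]

/-- A chosen orthonormal basis of `H`; the trace norm does not depend on this choice, see
`traceNorm_eq`. -/
noncomputable def someBasis (H : Type*) [NormedAddCommGroup H] [InnerProductSpace ℂ H]
    [CompleteSpace H] : HilbertBasis (exists_hilbertBasis ℂ H).choose ℂ H :=
  (exists_hilbertBasis ℂ H).choose_spec.choose

/-- The trace norm `‖A‖₁ = tr |A| ∈ [0, ∞]` of a bounded operator, `|A| = √(A† A)`. -/
noncomputable def traceNorm (A : H →L[ℂ] H) : ℝ≥0∞ :=
  traceAlong (someBasis H) (CFC.abs A)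

lemma traceAlong_star_mul_self_eq {ι κ : Type*} (b : HilbertBasis ι ℂ H)
    (c : HilbertBasis κ ℂ H) (S : H →L[ℂ] H) :
    traceAlong b (star S * S) = traceAlong c (S * star S) := by
  have key : ∀ i, RCLike.re ⟪b i, (star S * S) (b i)⟫_ℂ = ‖S (b i)‖ ^ 2 := by
    intro i
    rw [mul_apply_eq_comp, ContinuousLinearMap.star_eq_adjoint,
      ContinuousLinearMap.adjoint_inner_right]
    exact inner_self_eq_norm_sq (𝕜 := ℂ) (S (b i))
  have key2 : ∀ j, RCLike.re ⟪c j, (S * star S) (c j)⟫_ℂ = ‖(star S) (c j)‖ ^ 2 := by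
    intro j
    rw [mul_apply_eq_comp, ContinuousLinearMap.star_eq_adjoint,
      ← ContinuousLinearMap.adjoint_inner_left]
    exact inner_self_eq_norm_sq (𝕜 := ℂ) _
  unfold traceAlong
  simp_rw [key, key2]
  simp_rw [fun i => ofReal_norm_sq_eq_tsum c (S (b i)),
    fun j => ofReal_norm_sq_eq_tsum b ((star S) (c j))]
  rw [ENNReal.tsum_comm]
  refine tsum_congr fun j => tsum_congr fun i => ?_
  rw [ContinuousLinearMap.star_eq_adjoint, ContinuousLinearMap.adjoint_inner_right,
    norm_inner_symm]

/-- The trace of a positive semi-definite operator is the same in every orthonormal basis. -/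
lemma traceAlong_eq_of_nonneg {ι κ : Type*} (b : HilbertBasis ι ℂ H)
    (c : HilbertBasis κ ℂ H) {T : H →L[ℂ] H} (hT : 0 ≤ T) :
    traceAlong b T = traceAlong c T := by
  have hs : star (CFC.sqrt T) = CFC.sqrt T :=
    (IsSelfAdjoint.of_nonneg (CFC.sqrt_nonneg T)).star_eq
  have hm : CFC.sqrt T * CFC.sqrt T = T := CFC.sqrt_mul_sqrt_self T hT
  have h := traceAlong_star_mul_self_eq b c (CFC.sqrt T)
  rwa [hs, hm] at h

/-- The trace norm can be computed in any orthonormal basis. -/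
lemma traceNorm_eq {ι : Type*} (b : HilbertBasis ι ℂ H) (A : H →L[ℂ] H) :
    traceNorm A = traceAlong b (CFC.abs A) :=
  traceAlong_eq_of_nonneg _ _ (CFC.abs_nonneg A)

/-- The trace norm is invariant under unitary conjugation. -/
lemma traceNorm_conj (U : unitary (H →L[ℂ] H)) (A : H →L[ℂ] H) :
    traceNorm ((U : H →L[ℂ] H) * A * star (U : H →L[ℂ] H)) = traceNorm A := by
  have h1 : star (U : H →L[ℂ] H) * (U : H →L[ℂ] H) = 1 := Unitary.star_mul_self_of_mem U.2
  have habs : CFC.abs ((U : H →L[ℂ] H) * A * star (U : H →L[ℂ] H)) =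
      (U : H →L[ℂ] H) * CFC.abs A * star (U : H →L[ℂ] H) := by
    refine CFC.sqrt_unique ?_ (star_right_conjugate_nonneg (CFC.abs_nonneg A) _)
    have h2 : CFC.abs A * CFC.abs A = star A * A := CFC.abs_mul_abs A
    calc (U : H →L[ℂ] H) * CFC.abs A * star (U : H →L[ℂ] H) *
          ((U : H →L[ℂ] H) * CFC.abs A * star (U : H →L[ℂ] H))
        = (U : H →L[ℂ] H) * CFC.abs A * (star (U : H →L[ℂ] H) * (U : H →L[ℂ] H)) *
            CFC.abs A * star (U : H →L[ℂ] H) := by simp only [mul_assoc]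
      _ = (U : H →L[ℂ] H) * (CFC.abs A * CFC.abs A) * star (U : H →L[ℂ] H) := by
          rw [h1]; simp only [mul_assoc, one_mul]
      _ = (U : H →L[ℂ] H) * star A * (star (U : H →L[ℂ] H) * (U : H →L[ℂ] H)) * A *
            star (U : H →L[ℂ] H) := by rw [h2, h1]; simp only [mul_assoc, one_mul]
      _ = _ := by simp only [star_mul, star_star, mul_assoc]
  set S := CFC.sqrt (CFC.abs A) with hS
  have hs : star S = S := (IsSelfAdjoint.of_nonneg (CFC.sqrt_nonneg _)).star_eq
  have hm : S * S = CFC.abs A := CFC.sqrt_mul_sqrt_self _ (CFC.abs_nonneg A)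
  have h3 := traceAlong_star_mul_self_eq (someBasis H) (someBasis H)
    ((U : H →L[ℂ] H) * S)
  have e1 : star ((U : H →L[ℂ] H) * S) * ((U : H →L[ℂ] H) * S) = CFC.abs A := by
    rw [star_mul, hs, ← hm]
    calc S * star (U : H →L[ℂ] H) * ((U : H →L[ℂ] H) * S)
        = S * (star (U : H →L[ℂ] H) * (U : H →L[ℂ] H)) * S := by simp only [mul_assoc]
      _ = S * S := by rw [h1, mul_one]
  have e2 : (U : H →L[ℂ] H) * S * star ((U : H →L[ℂ] H) * S) =
      (U : H →L[ℂ] H) * CFC.abs A * star (U : H →L[ℂ] H) := by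
    rw [star_mul, hs, ← hm]; simp only [mul_assoc]
  rw [e1, e2] at h3
  rw [traceNorm, traceNorm, habs, h3]

end TraceNorm

/-- The space `L¹(H)` of trace-class operators: bounded operators `A` with `tr |A| < ∞`. It is a
structure so that it does not inherit the operator norm topology. -/
@[ext]
structure TraceClass (H : Type*) [NormedAddCommGroup H] [InnerProductSpace ℂ H]
    [CompleteSpace H] where
  /-- the underlying bounded operator -/
  op : H →L[ℂ] H
  traceNorm_lt_top : traceNorm op < ∞

section Orbit

variable {H : Type*} [NormedAddCommGroup H] [InnerProductSpace ℂ H] [CompleteSpace H]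

/-- The `L¹`-topology, that is, the topology of the distance `‖B - A‖₁`: a set is open if it
contains a ball of positive radius around each of its points. -/
instance : TopologicalSpace (TraceClass H) where
  IsOpen s := ∀ A ∈ s, ∃ ε : ℝ, 0 < ε ∧
    ∀ B : TraceClass H, traceNorm (B.op - A.op) < ENNReal.ofReal ε → B ∈ s
  isOpen_univ := fun _ _ => ⟨1, one_pos, fun _ _ => Set.mem_univ _⟩
  isOpen_inter := by
    rintro s t hs ht A ⟨hAs, hAt⟩
    obtain ⟨ε, hε, h⟩ := hs A hAs
    obtain ⟨δ, hδ, h'⟩ := ht A hAt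
    refine ⟨min ε δ, lt_min hε hδ, fun B hB => ⟨h B ?_, h' B ?_⟩⟩
    · exact hB.trans_le (ENNReal.ofReal_le_ofReal (min_le_left _ _))
    · exact hB.trans_le (ENNReal.ofReal_le_ofReal (min_le_right _ _))
  isOpen_sUnion := by
    rintro S hS A ⟨s, hs, hA⟩
    obtain ⟨ε, hε, h⟩ := hS s hs A hA
    exact ⟨ε, hε, fun B hB => ⟨s, hs, h B hB⟩⟩

/-- The action `A ↦ U A U†` of the unitary group on the trace-class operators. -/
noncomputable instance : MulAction (unitary (H →L[ℂ] H)) (TraceClass H) where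
  smul U A := ⟨(U : H →L[ℂ] H) * A.op * star (U : H →L[ℂ] H),
    (traceNorm_conj U A.op).trans_lt A.traceNorm_lt_top⟩
  one_smul A := TraceClass.ext <| by
    change ((1 : unitary (H →L[ℂ] H)) : H →L[ℂ] H) * A.op *
      star ((1 : unitary (H →L[ℂ] H)) : H →L[ℂ] H) = A.op
    simp
  mul_smul U V A := TraceClass.ext <| by
    change ((U * V : unitary (H →L[ℂ] H)) : H →L[ℂ] H) * A.op *
      star ((U * V : unitary (H →L[ℂ] H)) : H →L[ℂ] H) =
      (U : H →L[ℂ] H) * ((V : H →L[ℂ] H) * A.op * star (V : H →L[ℂ] H)) *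
        star (U : H →L[ℂ] H)
    simp [mul_assoc]

/-- The unitary coadjoint orbit `{U ρ U† : U unitary}` of `ρ`, as a subset of `L¹(H)`. -/
def coadjointOrbit (ρ : TraceClass H) : Set (TraceClass H) :=
  MulAction.orbit (unitary (H →L[ℂ] H)) ρ

/-- An operator is of finite rank if its range is finite-dimensional. -/
def IsFiniteRank (A : H →L[ℂ] H) : Prop :=
  FiniteDimensional ℂ (LinearMap.range (A : H →ₗ[ℂ] H))

end Orbit

end CoadjointOrbit

/-! Finite rank implies closed: a finite-rank self-adjoint `r` is annihilated by a polynomial with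
simple roots. If conjugates of `r` approach `a`, then `a` is self-adjoint with the same annihilator,
and the Lagrange basis polynomials `q z` yield the spectral projections of both. For a conjugate
close enough to `a`, the element `∑ q z (a) * q z (U r U†)` is invertible, and multiplied by `U` it
intertwines `r` with `a`; its unitary polar part conjugates `r` to `a`. Operator-norm approximation
suffices, and `ofReal_norm_le_traceNorm` supplies it.

Closed implies finite rank: a self-adjoint trace-class operator is compact, hence diagonal with
eigenvalues `l`. If the support of `l` is infinite, an injection of it into the countable index set
can fill the whole set when `l` has zeros and miss a point when it has none. The rearranged operator
is a trace-norm limit of conjugates of `ρ` by basis permutations (`exists_perm_tsum_lt`), yet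
exactly one of the two has a nonzero kernel vector, so it lies outside the orbit. -/

namespace CoadjointOrbit

/-! ### Unitary orbits of algebraic self-adjoint elements in a C⋆-algebra -/

section CStarAlgebra

open Polynomial

/-- The linear factors are pairwise coprime, so the nodal polynomial divides `p`. Polynomial
identities in `a` thus reduce to checks at the nodes. -/
lemma aeval_eq_zero_of_eval_eq_zero {𝓐 : Type*} [Ring 𝓐] [Algebra ℂ 𝓐] {s : Finset ℂ} {a : 𝓐}
    (ha : aeval a (Lagrange.nodal s id) = 0) {p : ℂ[X]} (hp : ∀ z ∈ s, p.eval z = 0) :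
    aeval a p = 0 := by
  have hdvd : Lagrange.nodal s id ∣ p := by
    rw [Lagrange.nodal_eq]
    refine Finset.prod_dvd_of_coprime (fun z _ w _ hzw => ?_) fun z hz => ?_
    · exact isCoprime_X_sub_C_of_isUnit_sub (sub_ne_zero.2 hzw).isUnit
    · exact dvd_iff_isRoot.2 (hp z hz)
  obtain ⟨q, rfl⟩ := hdvd
  rw [map_mul, ha, zero_mul]

variable {𝓐 : Type*} [CStarAlgebra 𝓐] [PartialOrder 𝓐] [StarOrderedRing 𝓐]

/-- Similar self-adjoint elements are unitarily equivalent: the unitary part of the polar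
decomposition of an invertible intertwiner is an intertwiner. -/
lemma exists_unitary_conj_of_isUnit {a r w : 𝓐} (ha : IsSelfAdjoint a) (hr : IsSelfAdjoint r)
    (hw : IsUnit w) (h : a * w = w * r) :
    ∃ V : unitary 𝓐, (V : 𝓐) * r * star (V : 𝓐) = a := by
  have h' : star w * a = r * star w := by
    have := congrArg star h
    rwa [star_mul, star_mul, ha.star_eq, hr.star_eq] at this
  have hc : Commute r (star w * w) := by
    rw [Commute, SemiconjBy, ← mul_assoc, ← h', mul_assoc, h, mul_assoc]
  have hcT : Commute r (CFC.abs w) := by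
    have : Commute (star w * w) r := hc.symm
    exact (Commute.cfcₙ_nnreal this _).symm
  have hT2 : CFC.abs w * CFC.abs w = star w * w := CFC.abs_mul_abs w
  have hTs : star (CFC.abs w) = CFC.abs w := (IsSelfAdjoint.of_nonneg (CFC.abs_nonneg w)).star_eq
  have hTu : IsUnit (CFC.abs w) := by
    have h1 : IsUnit (CFC.abs w * CFC.abs w) := hT2 ▸ hw.star.mul hw
    exact ((Commute.refl (CFC.abs w)).isUnit_mul_iff.1 h1).1
  obtain ⟨t, ht⟩ := hTu
  obtain ⟨v, rfl⟩ := hw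
  have hts : star (↑t⁻¹ : 𝓐) = ↑t⁻¹ := by
    have : star t = t := Units.ext (by rw [Units.coe_star, ht, hTs])
    rw [← Units.coe_star, star_inv, this]
  rw [← ht] at hT2 hcT
  have h1 : star ((v : 𝓐) * ↑t⁻¹) * ((v : 𝓐) * ↑t⁻¹) = 1 := by
    rw [star_mul, hts]
    calc (↑t⁻¹ : 𝓐) * star (v : 𝓐) * (v * ↑t⁻¹) = ↑t⁻¹ * (star (v : 𝓐) * v) * ↑t⁻¹ := by
          simp only [mul_assoc]
      _ = 1 := by rw [← hT2]; simp
  have hmem : (v : 𝓐) * ↑t⁻¹ ∈ unitary 𝓐 :=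
    IsUnit.mem_unitary_of_star_mul_self ⟨v * t⁻¹, Units.val_mul _ _⟩ h1
  have h2 : ((v : 𝓐) * ↑t⁻¹) * star ((v : 𝓐) * ↑t⁻¹) = 1 := Unitary.mul_star_self_of_mem hmem
  refine ⟨⟨(v : 𝓐) * ↑t⁻¹, hmem⟩, ?_⟩
  have hct : Commute r (↑t⁻¹ : 𝓐) := hcT.units_inv_right
  calc (v : 𝓐) * ↑t⁻¹ * r * star ((v : 𝓐) * ↑t⁻¹)
      = v * (r * ↑t⁻¹) * star ((v : 𝓐) * ↑t⁻¹) := by rw [hct.eq, mul_assoc (v : 𝓐)]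
    _ = a * ((v * ↑t⁻¹) * star ((v : 𝓐) * ↑t⁻¹)) := by
        rw [← mul_assoc, ← h]; simp only [mul_assoc]
    _ = a := by rw [h2, mul_one]

lemma star_conj_aeval (U : unitary 𝓐) (r : 𝓐) (p : ℂ[X]) :
    aeval ((U : 𝓐) * r * star (U : 𝓐)) p = U * aeval r p * star (U : 𝓐) := by
  have := aeval_algHom_apply (Unitary.conjStarAlgAut ℂ 𝓐 U : 𝓐 →ₐ[ℂ] 𝓐) r p
  simpa using this

/-- The unitary orbit of a self-adjoint element annihilated by a polynomial with simple roots is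
closed in norm. -/
lemma exists_unitary_conj_of_forall_exists_norm_lt {r a : 𝓐} (hr : IsSelfAdjoint r)
    {s : Finset ℂ} (hrs : aeval r (Lagrange.nodal s id) = 0)
    (h : ∀ ε : ℝ, 0 < ε → ∃ U : unitary 𝓐, ‖(U : 𝓐) * r * star (U : 𝓐) - a‖ < ε) :
    ∃ V : unitary 𝓐, (V : 𝓐) * r * star (V : 𝓐) = a := by
  have hcl : a ∈ closure {x : 𝓐 | ∃ U : unitary 𝓐, (U : 𝓐) * r * star (U : 𝓐) = x} := by
    refine Metric.mem_closure_iff.2 fun ε hε => ?_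
    obtain ⟨U, hU⟩ := h ε hε
    exact ⟨_, ⟨U, rfl⟩, by rwa [dist_comm, dist_eq_norm]⟩
  have ha : IsSelfAdjoint a := by
    have hc : IsClosed {x : 𝓐 | star x = x} := isClosed_eq continuous_star continuous_id
    refine closure_minimal ?_ hc hcl
    rintro _ ⟨U, rfl⟩
    exact (hr.conjugate (U : 𝓐)).star_eq
  have has : aeval a (Lagrange.nodal s id) = 0 := by
    have hc : IsClosed {x : 𝓐 | aeval x (Lagrange.nodal s id) = 0} :=
      isClosed_eq (Polynomial.continuous_aeval _) continuous_const
    refine closure_minimal ?_ hc hcl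
    rintro _ ⟨U, rfl⟩
    simp [star_conj_aeval, hrs]
  -- `q z` evaluated at `a` is the spectral projection for `z` (zero if `z` is not an eigenvalue);
  -- `f x` compares these projections for `a` and `x`.
  let q : ℂ → ℂ[X] := Lagrange.basis s id
  let f : 𝓐 → 𝓐 := fun x => ∑ z ∈ s, aeval a (q z) * aeval x (q z)
  have hf : Continuous f := continuous_finsetSum _ fun z _ =>
    continuous_const.mul (Polynomial.continuous_aeval _)
  have hq : ∀ z ∈ s, ∀ w ∈ s, (q z).eval w = if z = w then 1 else 0 := by
    intro z hz w hw
    split_ifs with hzw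
    · subst hzw
      exact Lagrange.eval_basis_self Function.injective_id.injOn hz
    · exact Lagrange.eval_basis_of_ne (v := id) hzw hw
  have hfa : f a = 1 := by
    have h0 : aeval a (∑ z ∈ s, q z * q z - 1) = 0 := by
      refine aeval_eq_zero_of_eval_eq_zero has fun w hw => ?_
      rw [eval_sub, eval_finsetSum, eval_one, Finset.sum_eq_single_of_mem w hw]
      · rw [eval_mul, hq w hw w hw]; simp
      · intro z hz hzw
        rw [eval_mul, hq z hz w hw]; simp [hzw]
    rw [map_sub, map_sum, map_one, sub_eq_zero] at h0
    simpa only [map_mul] using h0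
  have hnhds : f ⁻¹' {x | IsUnit x} ∈ nhds a := by
    refine hf.continuousAt.preimage_mem_nhds ?_
    rw [hfa]
    exact Units.isOpen.mem_nhds isUnit_one
  obtain ⟨x, hx, U, rfl⟩ := mem_closure_iff_nhds.1 hcl _ hnhds
  have hUu : IsUnit (U : 𝓐) := ⟨Unitary.toUnits U, rfl⟩
  have hUU : star (U : 𝓐) * (U : 𝓐) = 1 := Unitary.star_mul_self_of_mem U.2
  -- The intertwiner is `f (U r U†) * U = ∑ q z (a) * U * q z (r)`; multiplying by `a` on the left
  -- or by `r` on the right scales each term by `z`.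
  refine exists_unitary_conj_of_isUnit ha hr ((show IsUnit _ from hx).mul hUu) ?_
  have key : ∀ (b : 𝓐), aeval b (Lagrange.nodal s id) = 0 → ∀ z ∈ s,
      b * aeval b (q z) = z • aeval b (q z) := by
    intro b hb z hz
    have h0 : aeval b (X * q z - C z * q z) = 0 := by
      refine aeval_eq_zero_of_eval_eq_zero hb fun w hw => ?_
      rw [eval_sub, eval_mul, eval_mul, hq z hz w hw, eval_X, eval_C]
      split_ifs with hzw
      · rw [hzw, sub_self]
      · simp
    rw [map_sub, map_mul, map_mul, aeval_X, aeval_C, sub_eq_zero] at h0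
    rw [h0, Algebra.smul_def]
  simp only [f, star_conj_aeval, Finset.mul_sum, Finset.sum_mul]
  refine Finset.sum_congr rfl fun z hz => ?_
  have e1 : aeval a (q z) * (U * aeval r (q z) * star (U : 𝓐)) * U =
      aeval a (q z) * U * aeval r (q z) := by
    calc _ = aeval a (q z) * U * aeval r (q z) * (star (U : 𝓐) * U) := by simp only [mul_assoc]
      _ = _ := by rw [hUU, mul_one]
  have e2 : aeval r (q z) * r = z • aeval r (q z) := by
    rw [← key r hrs z hz]
    simpa using ((Commute.all (q z) X).map (aeval r)).eq
  rw [e1, mul_assoc _ _ r, e2, ← mul_assoc, ← mul_assoc, key a has z hz]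
  simp only [smul_mul_assoc, mul_smul_comm]

end CStarAlgebra

/-! ### Compactness and diagonalisation of self-adjoint trace-class operators -/

section TraceClassCompact

universe u

variable {H : Type u} [NormedAddCommGroup H] [InnerProductSpace ℂ H]

lemma inner_basis {ι : Type*} [DecidableEq ι] (b : HilbertBasis ι ℂ H) (i j : ι) :
    ⟪b i, b j⟫_ℂ = if i = j then 1 else 0 :=
  orthonormal_iff_ite.1 b.orthonormal i j

lemma hilbertBasis_ext {ι : Type*} (b : HilbertBasis ι ℂ H) {x y : H}
    (h : ∀ i, ⟪b i, x⟫_ℂ = ⟪b i, y⟫_ℂ) : x = y := by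
  refine b.repr.injective (lp.ext (funext fun i => ?_))
  rw [b.repr_apply_apply, b.repr_apply_apply, h i]

lemma clm_ext_hilbertBasis {ι : Type*} (b : HilbertBasis ι ℂ H) {S T : H →L[ℂ] H}
    (h : ∀ i, S (b i) = T (b i)) : S = T := by
  refine ContinuousLinearMap.ext_on (s := Set.range b) ?_ ?_
  · exact (Submodule.dense_iff_topologicalClosure_eq_top).2 b.dense_span
  · rintro _ ⟨i, rfl⟩
    exact h i

/-- The finite-rank truncation of an operator to the coordinates in `s`. -/
noncomputable def truncation {ι : Type*} (b : HilbertBasis ι ℂ H) (S : H →L[ℂ] H)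
    (s : Finset ι) : H →L[ℂ] H :=
  ∑ i ∈ s, (InnerProductSpace.rankOne ℂ (b i) (b i)).comp S

lemma truncation_apply {ι : Type*} (b : HilbertBasis ι ℂ H) (S : H →L[ℂ] H)
    (s : Finset ι) (x : H) : truncation b S s x = ∑ i ∈ s, ⟪b i, S x⟫_ℂ • b i := by
  simp [truncation]

lemma isCompactOperator_truncation {ι : Type*} (b : HilbertBasis ι ℂ H) (S : H →L[ℂ] H)
    (s : Finset ι) : IsCompactOperator (truncation b S s) := by
  change truncation b S s ∈ compactOperator (RingHom.id ℂ) H H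
  refine Submodule.sum_mem _ fun i _ => ?_
  change IsCompactOperator
    ((ContinuousLinearMap.toSpanSingleton ℂ (b i)).comp ((innerSL ℂ (b i)).comp S))
  have h : IsCompactOperator (innerSL ℂ (b i)) :=
    isCompactOperator_of_locallyCompactSpace_dom _
  exact (h.comp_clm S).clm_comp (ContinuousLinearMap.toSpanSingleton ℂ (b i))

variable [CompleteSpace H]

lemma inner_apply_of_isSelfAdjoint {S : H →L[ℂ] H} (hS : IsSelfAdjoint S) (x y : H) :
    ⟪x, S y⟫_ℂ = ⟪S x, y⟫_ℂ :=
  (hS.isSymmetric x y).symm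

/-- The coordinates of `S x` outside `s` are `⟪S (b i), x⟫`; Cauchy–Schwarz bounds each one. -/
lemma ofReal_norm_sub_truncation_sq_le {ι : Type*} (b : HilbertBasis ι ℂ H) {S : H →L[ℂ] H}
    (hS : IsSelfAdjoint S) (s : Finset ι) (x : H) :
    ENNReal.ofReal (‖S x - truncation b S s x‖ ^ 2) ≤
      (∑' i : {i // i ∉ s}, ENNReal.ofReal (‖S (b i)‖ ^ 2)) * ENNReal.ofReal (‖x‖ ^ 2) := by
  classical
  have hco : ∀ i, ⟪b i, S x - truncation b S s x⟫_ℂ = if i ∈ s then 0 else ⟪b i, S x⟫_ℂ := by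
    intro i
    rw [inner_sub_right, truncation_apply, inner_sum]
    simp only [inner_smul_right, inner_basis, mul_ite, mul_one, mul_zero, Finset.sum_ite_eq]
    split_ifs <;> simp
  rw [ofReal_norm_sq_eq_tsum b, ← ENNReal.tsum_mul_right]
  have hsub : Function.support (fun i => ENNReal.ofReal
      (‖⟪b i, S x - truncation b S s x⟫_ℂ‖ ^ 2)) ⊆ {i | i ∉ s} := by
    intro i hi his
    exact hi (by simp [hco, his])
  rw [← tsum_subtype_eq_of_support_subset hsub]
  refine ENNReal.tsum_le_tsum fun i => ?_
  rw [← ENNReal.ofReal_mul (by positivity), ← mul_pow]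
  refine ENNReal.ofReal_le_ofReal (pow_le_pow_left₀ (norm_nonneg _) ?_ 2)
  have hi : (i : ι) ∉ s := i.2
  rw [hco, if_neg hi, inner_apply_of_isSelfAdjoint hS]
  exact norm_inner_le_norm _ _

/-- A self-adjoint Hilbert-Schmidt operator is compact. -/
lemma isCompactOperator_of_tsum_ne_top {ι : Type*} (b : HilbertBasis ι ℂ H) {S : H →L[ℂ] H}
    (hS : IsSelfAdjoint S) (h : ∑' i, ENNReal.ofReal (‖S (b i)‖ ^ 2) ≠ ∞) :
    IsCompactOperator S := by
  refine isCompactOperator_of_tendsto (l := Filter.atTop) (F := truncation b S) ?_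
    (Filter.Eventually.of_forall (isCompactOperator_truncation b S))
  rw [Metric.tendsto_nhds]
  intro ε hε
  have hlim := ENNReal.tendsto_tsum_compl_atTop_zero h
  have hε2 : (0 : ℝ≥0∞) < ENNReal.ofReal ((ε / 2) ^ 2) := ENNReal.ofReal_pos.2 (by positivity)
  filter_upwards [hlim.eventually (gt_mem_nhds hε2)] with s hs
  rw [dist_comm, dist_eq_norm]
  refine lt_of_le_of_lt (ContinuousLinearMap.opNorm_le_bound _ (by positivity) fun x => ?_)
    (half_lt_self hε)
  have h1 := (ofReal_norm_sub_truncation_sq_le b hS s x).trans (mul_le_mul_left hs.le _)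
  rw [← ENNReal.ofReal_mul (by positivity), ENNReal.ofReal_le_ofReal_iff (by positivity),
    ← mul_pow] at h1
  exact le_of_sq_le_sq h1 (by positivity)

lemma norm_abs_apply (T : H →L[ℂ] H) (x : H) : ‖CFC.abs T x‖ = ‖T x‖ := by
  have h : CFC.abs T * CFC.abs T = star T * T := CFC.abs_mul_abs T
  have hs : IsSelfAdjoint (CFC.abs T) := IsSelfAdjoint.of_nonneg (CFC.abs_nonneg T)
  have h1 : ⟪CFC.abs T x, CFC.abs T x⟫_ℂ = ⟪T x, T x⟫_ℂ := by
    rw [← inner_apply_of_isSelfAdjoint hs, ← mul_apply_eq_comp, h,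
      mul_apply_eq_comp, ContinuousLinearMap.star_eq_adjoint,
      ContinuousLinearMap.adjoint_inner_right]
  rw [inner_self_eq_norm_sq_to_K, inner_self_eq_norm_sq_to_K] at h1
  exact (sq_eq_sq₀ (norm_nonneg _) (norm_nonneg _)).1 (by exact_mod_cast h1)

/-- With `S` the square root of `|T|`, the trace norm of `T` becomes the squared Hilbert–Schmidt
norm of `S`, so Hilbert–Schmidt estimates apply. -/
lemma exists_isSelfAdjoint_sq_eq_abs (T : H →L[ℂ] H) :
    ∃ S : H →L[ℂ] H, IsSelfAdjoint S ∧ S * S = CFC.abs T ∧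
      ∀ {ι : Type u} (b : HilbertBasis ι ℂ H),
        traceNorm T = ∑' i, ENNReal.ofReal (‖S (b i)‖ ^ 2) := by
  obtain ⟨S, hS, hm⟩ : ∃ S : H →L[ℂ] H, IsSelfAdjoint S ∧ S * S = CFC.abs T :=
    ⟨CFC.sqrt (CFC.abs T), IsSelfAdjoint.of_nonneg (CFC.sqrt_nonneg _),
      CFC.sqrt_mul_sqrt_self _ (CFC.abs_nonneg T)⟩
  refine ⟨S, hS, hm, fun b => ?_⟩
  rw [traceNorm_eq b, traceAlong]
  refine tsum_congr fun i => ?_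
  rw [← hm, mul_apply_eq_comp, inner_apply_of_isSelfAdjoint hS]
  congr 1
  exact inner_self_eq_norm_sq (𝕜 := ℂ) (S (b i))

/-- The trace norm dominates the operator norm. -/
lemma ofReal_norm_le_traceNorm (T : H →L[ℂ] H) : ENNReal.ofReal ‖T‖ ≤ traceNorm T := by
  obtain ⟨S, hS, hm, htr⟩ := exists_isSelfAdjoint_sq_eq_abs T
  rcases eq_or_ne (traceNorm T) ∞ with h | h
  · rw [h]; exact le_top
  have h1 : ‖S‖ ≤ Real.sqrt (traceNorm T).toReal := by
    refine ContinuousLinearMap.opNorm_le_bound _ (Real.sqrt_nonneg _) fun x => ?_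
    -- The empty truncation is zero, which leaves the bound of the operator norm of `S` by its
    -- Hilbert–Schmidt norm.
    have h2 := ofReal_norm_sub_truncation_sq_le (someBasis H) hS ∅ x
    have h3 : ∑' i : {i // i ∉ (∅ : Finset (exists_hilbertBasis ℂ H).choose)},
        ENNReal.ofReal (‖S (someBasis H i)‖ ^ 2) ≤ traceNorm T := by
      rw [htr (someBasis H)]
      exact ENNReal.tsum_comp_le_tsum_of_injective Subtype.val_injective _
    have h4 := h2.trans (mul_le_mul_left h3 _)
    rw [← ENNReal.ofReal_toReal h, ← ENNReal.ofReal_mul ENNReal.toReal_nonneg,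
      ENNReal.ofReal_le_ofReal_iff (by positivity), truncation_apply, Finset.sum_empty,
      sub_zero] at h4
    refine le_of_sq_le_sq ?_ (by positivity)
    rwa [mul_pow, Real.sq_sqrt ENNReal.toReal_nonneg]
  refine ENNReal.ofReal_le_of_le_toReal ?_
  calc ‖T‖ = ‖S * S‖ := by rw [hm, CFC.norm_abs]
    _ ≤ ‖S‖ * ‖S‖ := norm_mul_le _ _
    _ ≤ Real.sqrt (traceNorm T).toReal * Real.sqrt (traceNorm T).toReal := by gcongr
    _ = (traceNorm T).toReal := Real.mul_self_sqrt ENNReal.toReal_nonneg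

/-- A self-adjoint trace-class operator is compact. -/
lemma isCompactOperator_of_traceNorm_lt_top {T : H →L[ℂ] H} (hT : IsSelfAdjoint T)
    (h : traceNorm T < ∞) : IsCompactOperator T := by
  obtain ⟨S, -, hm, htr⟩ := exists_isSelfAdjoint_sq_eq_abs T
  -- `T` is itself Hilbert–Schmidt, since `‖T (b i)‖ = ‖S (S (b i))‖ ≤ ‖S‖ * ‖S (b i)‖`.
  refine isCompactOperator_of_tsum_ne_top (someBasis H) hT (ne_top_of_le_ne_top
    (ENNReal.mul_ne_top (ENNReal.ofReal_ne_top (r := ‖S‖ ^ 2)) h.ne) ?_)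
  rw [htr (someBasis H), ← ENNReal.tsum_mul_left]
  refine ENNReal.tsum_le_tsum fun i => ?_
  rw [← ENNReal.ofReal_mul (by positivity), ← mul_pow, ← norm_abs_apply, ← hm]
  exact ENNReal.ofReal_le_ofReal (pow_le_pow_left₀ (norm_nonneg _) (S.le_opNorm _) 2)

open Module.End in
/-- A self-adjoint compact operator is diagonal in some Hilbert basis. -/
lemma exists_hilbertBasis_apply_eq_smul {T : H →L[ℂ] H} (hT : IsSelfAdjoint T)
    (hc : IsCompactOperator T) :
    ∃ (ι : Type u) (b : HilbertBasis ι ℂ H) (l : ι → ℝ), ∀ i, T (b i) = (l i : ℂ) • b i := by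
  have hs : (T : H →ₗ[ℂ] H).IsSymmetric := hT.isSymmetric
  have hcl : ∀ μ : ℂ, CompleteSpace (eigenspace (T : H →ₗ[ℂ] H) μ) := fun μ => by
    have : IsClosed {x : H | T x = μ • x} :=
      isClosed_eq T.continuous (continuous_const_smul μ)
    refine IsClosed.completeSpace_coe (hs := ?_)
    convert this using 1
    ext x
    exact mem_eigenspace_iff
  choose w b hb using fun μ : ℂ => exists_hilbertBasis ℂ (eigenspace (T : H →ₗ[ℂ] H) μ)
  have hon : Orthonormal ℂ fun a : Σ μ, w μ =>
      ((b a.1 a.2 : eigenspace (T : H →ₗ[ℂ] H) a.1) : H) :=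
    hs.orthogonalFamily_eigenspaces.orthonormal_sigma_orthonormal
      (v_family := fun μ i => b μ i) fun μ => (b μ).orthonormal
  have heig : ∀ a : Σ μ, w μ, T (b a.1 a.2 : H) = a.1 • (b a.1 a.2 : H) :=
    fun a => mem_eigenspace_iff.1 (b a.1 a.2).2
  refine ⟨Σ μ, w μ, HilbertBasis.mkOfOrthogonalEqBot hon ?_, fun a => a.1.re, fun a => ?_⟩
  · rw [eq_bot_iff, ← ContinuousLinearMap.orthogonalComplement_iSup_eigenspaces_eq_bot hc hs]
    intro x hx
    rw [Submodule.mem_orthogonal] at hx ⊢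
    intro u hu
    -- A vector orthogonal to the basis of each eigenspace is orthogonal to the eigenspace, by
    -- continuity of the inner product.
    have hle : (⨆ μ, eigenspace (T : H →ₗ[ℂ] H) μ) ≤ (ℂ ∙ x)ᗮ := by
      refine iSup_le fun μ y hy => ?_
      rw [Submodule.mem_orthogonal_singleton_iff_inner_left]
      have h1 := ((b μ).hasSum_repr ⟨y, hy⟩).mapL (eigenspace (T : H →ₗ[ℂ] H) μ).subtypeL
      have h2 := h1.mapL (innerSL ℂ x)
      have h3 : ⟪x, y⟫_ℂ = 0 := by
        refine h2.unique ?_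
        convert hasSum_zero with i
        have h4 := hx _ (Submodule.subset_span ⟨⟨μ, i⟩, rfl⟩)
        simp only [map_smul, smul_eq_mul]
        refine mul_eq_zero_of_right _ ?_
        exact inner_eq_zero_symm.1 h4
      exact inner_eq_zero_symm.1 h3
    exact Submodule.mem_orthogonal_singleton_iff_inner_left.1 (hle hu)
  · rw [HilbertBasis.coe_mkOfOrthogonalEqBot]
    have hne : (b a.1 a.2 : H) ≠ 0 := hon.ne_zero a
    have hre : (starRingEnd ℂ) a.1 = a.1 := hs.conj_eigenvalue_eq_self
      (hasEigenvalue_of_hasEigenvector ⟨(b a.1 a.2).2, hne⟩)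
    rw [heig, Complex.conj_eq_iff_re.1 hre]

end TraceClassCompact

/-! ### Operators diagonal in a Hilbert basis -/

section Diagonal

variable {H : Type*} [NormedAddCommGroup H] [InnerProductSpace ℂ H]
  {ι : Type*} {b : HilbertBasis ι ℂ H} {T : H →L[ℂ] H} {l : ι → ℝ}

lemma aeval_apply_of_apply_eq_smul {z : ℂ} {x : H} (h : T x = z • x) (p : Polynomial ℂ) :
    Polynomial.aeval T p x = p.eval z • x := by
  induction p using Polynomial.induction_on' with
  | add p q hp hq => simp [hp, hq, add_smul]
  | monomial n c =>
    have hn : (T ^ n) x = z ^ n • x := by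
      induction n with
      | zero => simp
      | succ n ih => rw [pow_succ, mul_apply_eq_comp, h, map_smul, ih, smul_smul, pow_succ']
    rw [Polynomial.aeval_monomial, Polynomial.eval_monomial, ← Algebra.smul_def,
      smul_apply, hn, smul_smul]

/-- Distinct basis vectors are at distance `√2`, so balls of radius `1 / 2` around them are
disjoint. -/
lemma countable_of_hilbertBasis [TopologicalSpace.SeparableSpace H] (b : HilbertBasis ι ℂ H) :
    Countable ι := by
  classical
  refine Pairwise.countable_of_isOpen_disjoint (s := fun i => Metric.ball (b i) (1 / 2)) ?_
    (fun i => Metric.isOpen_ball) fun i => Metric.nonempty_ball.2 (by norm_num)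
  intro i j hij
  refine Metric.ball_disjoint_ball ?_
  have h1 : ‖b i - b j‖ ^ 2 = 2 := by
    rw [@norm_sub_sq ℂ, inner_basis, if_neg hij, b.orthonormal.norm_eq_one,
      b.orthonormal.norm_eq_one]
    norm_num
  rw [dist_eq_norm]
  nlinarith [norm_nonneg (b i - b j)]

lemma isFiniteRank_iff_of_diagonal (h : ∀ i, T (b i) = (l i : ℂ) • b i) :
    IsFiniteRank T ↔ (Function.support l).Finite := by
  classical
  constructor
  · intro hfin
    have : FiniteDimensional ℂ (LinearMap.range (T : H →ₗ[ℂ] H)) := hfin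
    let v : Function.support l → LinearMap.range (T : H →ₗ[ℂ] H) := fun i =>
      ⟨b i, (l i : ℂ)⁻¹ • b i, by
        have hi : (l i : ℂ) ≠ 0 := Complex.ofReal_ne_zero.2 i.2
        change T ((l i : ℂ)⁻¹ • b i) = b i
        rw [map_smul, h, smul_smul, inv_mul_cancel₀ hi, one_smul]⟩
    have hv : LinearIndependent ℂ v := by
      refine LinearIndependent.of_comp (LinearMap.range (T : H →ₗ[ℂ] H)).subtype ?_
      exact b.orthonormal.linearIndependent.comp _ Subtype.val_injective
    exact Set.finite_coe_iff.1 hv.finite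
  · intro hfin
    have hT : T = truncation b T hfin.toFinset := by
      refine clm_ext_hilbertBasis b fun j => ?_
      simp only [truncation_apply, h, inner_smul_right, inner_basis, mul_ite, mul_one, mul_zero,
        ite_smul, zero_smul, Finset.sum_ite_eq', Set.Finite.mem_toFinset, Function.mem_support]
      split_ifs with hj
      · rfl
      · rw [not_not.1 hj]; simp
    have hle : LinearMap.range (T : H →ₗ[ℂ] H) ≤
        Submodule.span ℂ ((hfin.toFinset.image b : Finset H) : Set H) := by
      rintro _ ⟨x, rfl⟩
      change T x ∈ _
      rw [hT, truncation_apply]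
      exact Submodule.sum_mem _ fun i hi => Submodule.smul_mem _ _
        (Submodule.subset_span (Finset.mem_coe.2 (Finset.mem_image_of_mem b hi)))
    exact Submodule.finiteDimensional_of_le hle

variable [CompleteSpace H]

lemma isSelfAdjoint_of_diagonal (h : ∀ i, T (b i) = (l i : ℂ) • b i) : IsSelfAdjoint T := by
  classical
  rw [ContinuousLinearMap.isSelfAdjoint_iff']
  refine clm_ext_hilbertBasis b fun i => hilbertBasis_ext b fun j => ?_
  rw [ContinuousLinearMap.adjoint_inner_right, h, h, inner_smul_left, inner_smul_right,
    inner_basis, Complex.conj_ofReal]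
  split_ifs with hij
  · rw [hij]
  · simp

/-- The square of `|T|` scales `b i` by `l i ^ 2`; positivity of `|T|` selects the nonnegative root.
-/
lemma abs_apply_of_diagonal (h : ∀ i, T (b i) = (l i : ℂ) • b i) (i : ι) :
    CFC.abs T (b i) = ((|l i| : ℝ) : ℂ) • b i := by
  have hT := isSelfAdjoint_of_diagonal h
  have hsq : CFC.abs T (CFC.abs T (b i)) = ((|l i| : ℝ) : ℂ) • ((|l i| : ℝ) : ℂ) • b i := by
    have h1 : CFC.abs T * CFC.abs T = star T * T := CFC.abs_mul_abs T
    rw [← mul_apply_eq_comp, h1, hT.star_eq, mul_apply_eq_comp, h, map_smul, h, smul_smul,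
      smul_smul, ← Complex.ofReal_mul, ← Complex.ofReal_mul, abs_mul_abs_self]
  rcases eq_or_ne (l i) 0 with h0 | h0
  · have h2 : ‖CFC.abs T (b i)‖ = 0 := by rw [norm_abs_apply, h, h0]; simp
    rw [norm_eq_zero.1 h2, h0]; simp
  · -- `|T| + |l i|` is injective and kills `|T| b i - |l i| b i`
    set c : ℝ := |l i| with hc
    have hcpos : 0 < c := abs_pos.2 h0
    set y : H := CFC.abs T (b i) - (c : ℂ) • b i with hy
    have h3 : CFC.abs T y = -((c : ℂ) • y) := by
      rw [hy, map_sub, hsq, map_smul, smul_sub, neg_sub]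
    have hpos : 0 ≤ RCLike.re ⟪CFC.abs T y, y⟫_ℂ :=
      ((ContinuousLinearMap.nonneg_iff_isPositive _).1 (CFC.abs_nonneg T)).re_inner_nonneg_left y
    rw [h3, inner_neg_left, inner_smul_left, Complex.conj_ofReal, inner_self_eq_norm_sq_to_K] at hpos
    have h4 : 0 ≤ -(c * ‖y‖ ^ 2) := by
      convert hpos using 1
      simp [← Complex.ofReal_pow]
    have h5 : ‖y‖ = 0 := by
      by_contra hne
      have : 0 < ‖y‖ ^ 2 := by positivity
      nlinarith
    exact sub_eq_zero.1 (norm_eq_zero.1 h5)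

lemma traceNorm_of_diagonal (h : ∀ i, T (b i) = (l i : ℂ) • b i) :
    traceNorm T = ∑' i, ENNReal.ofReal |l i| := by
  classical
  rw [traceNorm_eq b, traceAlong]
  refine tsum_congr fun i => ?_
  rw [abs_apply_of_diagonal h, inner_smul_right, inner_basis]
  simp

/-- The series of rank-one projections weighted by `l` converges absolutely in operator norm. -/
lemma exists_diagonal (b : HilbertBasis ι ℂ H) (h : ∑' i, ENNReal.ofReal |l i| ≠ ∞) :
    ∃ T : H →L[ℂ] H, ∀ i, T (b i) = (l i : ℂ) • b i := by
  classical
  have hsum : Summable fun i => |l i| := by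
    have := ENNReal.summable_toReal h
    simpa only [ENNReal.toReal_ofReal (abs_nonneg _)] using this
  have hs : Summable fun i => (l i : ℂ) • InnerProductSpace.rankOne ℂ (b i) (b i) := by
    refine Summable.of_norm (hsum.congr fun i => ?_)
    rw [norm_smul, InnerProductSpace.norm_rankOne, b.orthonormal.norm_eq_one]
    simp
  refine ⟨∑' i, (l i : ℂ) • InnerProductSpace.rankOne ℂ (b i) (b i), fun j => ?_⟩
  have h1 := hs.hasSum.mapL (ContinuousLinearMap.apply ℂ H (b j))
  refine h1.unique ?_
  convert hasSum_ite_eq j ((l j : ℂ) • b j) using 2 with i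
  simp only [ContinuousLinearMap.apply_apply, smul_apply,
    InnerProductSpace.rankOne_apply, inner_basis]
  split_ifs with hij
  · rw [hij, one_smul]
  · simp

lemma exists_ne_zero_apply_eq_zero_iff (h : ∀ i, T (b i) = (l i : ℂ) • b i) :
    (∃ x ≠ 0, T x = 0) ↔ ∃ i, l i = 0 := by
  constructor
  · rintro ⟨x, hx, hTx⟩
    by_contra! hl
    refine hx (hilbertBasis_ext b fun i => ?_)
    have h1 : ⟪T (b i), x⟫_ℂ = 0 := by
      rw [← inner_apply_of_isSelfAdjoint (isSelfAdjoint_of_diagonal h), hTx, inner_zero_right]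
    rw [h, inner_smul_left, Complex.conj_ofReal] at h1
    rw [inner_zero_right]
    exact (mul_eq_zero.1 h1).resolve_left (Complex.ofReal_ne_zero.2 (hl i))
  · rintro ⟨i, hi⟩
    exact ⟨b i, b.orthonormal.ne_zero i, by rw [h, hi]; simp⟩

/-- The unitary operator permuting the vectors of a Hilbert basis. -/
lemma exists_unitary_apply_eq (b : HilbertBasis ι ℂ H) (σ : Equiv.Perm ι) :
    ∃ U : unitary (H →L[ℂ] H), ∀ i, (U : H →L[ℂ] H) (b i) = b (σ i) := by
  have hd : ⊤ ≤ (Submodule.span ℂ (Set.range (b ∘ σ))).topologicalClosure := by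
    rw [EquivLike.range_comp, b.dense_span]
  let c : HilbertBasis ι ℂ H := HilbertBasis.mk (b.orthonormal.comp σ σ.injective) hd
  refine ⟨Unitary.linearIsometryEquiv.symm (b.repr.trans c.repr.symm), fun i => ?_⟩
  classical
  change c.repr.symm (b.repr (b i)) = b (σ i)
  rw [b.repr_self, c.repr_symm_single]
  exact congrFun (HilbertBasis.coe_mk _ hd) i

lemma conj_diagonal (h : ∀ i, T (b i) = (l i : ℂ) • b i) {U : unitary (H →L[ℂ] H)}
    {σ : Equiv.Perm ι} (hU : ∀ i, (U : H →L[ℂ] H) (b i) = b (σ i)) (j : ι) :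
    ((U : H →L[ℂ] H) * T * star (U : H →L[ℂ] H)) (b j) = (l (σ.symm j) : ℂ) • b j := by
  have h1 : star (U : H →L[ℂ] H) (b j) = b (σ.symm j) := by
    have h2 : (U : H →L[ℂ] H) (b (σ.symm j)) = b j := by rw [hU, σ.apply_symm_apply]
    rw [← h2, ← mul_apply_eq_comp, Unitary.star_mul_self_of_mem U.2]
    rfl
  rw [mul_apply_eq_comp, mul_apply_eq_comp, h1, h, map_smul, hU, σ.apply_symm_apply]

end Diagonal

/-! ### Rearranging a summable family along an injection of its support -/

section Rearrangement

variable {ι : Type*}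

/-- An infinite subset of a countable type can be moved injectively inside the type so that it
becomes everything if it was not, and not everything if it was. -/
lemma exists_embedding_surjective_iff [Countable ι] {s : Set ι} (hs : s.Infinite) :
    ∃ g : s ↪ ι, (Function.Surjective g ↔ s ≠ Set.univ) := by
  have : Infinite s := hs.to_subtype
  have : Infinite ι := Infinite.of_injective _ (Subtype.val_injective (p := (· ∈ s)))
  obtain ⟨e⟩ : Nonempty (s ≃ ι) := nonempty_equiv_of_countable
  by_cases h : s = Set.univ
  -- Hilbert's hotel: after the bijection with `ι`, a shift by one leaves `n.symm 0` uncovered.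
  · obtain ⟨n⟩ : Nonempty (ι ≃ ℕ) := nonempty_equiv_of_countable
    refine ⟨e.toEmbedding.trans (n.toEmbedding.trans
      ((⟨Nat.succ, Nat.succ_injective⟩ : ℕ ↪ ℕ).trans n.symm.toEmbedding)), ?_⟩
    refine iff_of_false (fun hsurj => ?_) (fun hne => hne h)
    obtain ⟨x, hx⟩ := hsurj (n.symm 0)
    have hx' : n.symm (Nat.succ (n (e x))) = n.symm 0 := hx
    exact Nat.succ_ne_zero _ (n.symm.injective hx')
  · exact ⟨e.toEmbedding, iff_of_true e.surjective h⟩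

/-- Any injective rearrangement of the support of a summable family is a limit in `ℓ¹` of
permutations. -/
lemma exists_perm_tsum_lt (l : ι → ℝ) (h : ∑' i, ENNReal.ofReal |l i| ≠ ∞)
    (g : Function.support l ↪ ι) {ε : ℝ≥0∞} (hε : 0 < ε) :
    ∃ σ : Equiv.Perm ι, ∑' j, ENNReal.ofReal
      |l (σ.symm j) - Function.extend g (fun i => l i) 0 j| < ε := by
  classical
  set m : ι → ℝ := Function.extend g (fun i => l i) 0 with hm
  set L : Function.support l → ℝ≥0∞ := fun i => ENNReal.ofReal |l i| with hL
  have hL_ne : ∑' i, L i ≠ ∞ :=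
    ne_top_of_le_ne_top h (ENNReal.tsum_comp_le_tsum_of_injective Subtype.val_injective _)
  have hlim := ENNReal.tendsto_tsum_compl_atTop_zero hL_ne
  obtain ⟨s, hs⟩ := (hlim.eventually (gt_mem_nhds (ENNReal.half_pos hε.ne'))).exists
  -- An injection defined on a finite subset extends to a permutation; here it is `g` restricted to
  -- `s`, which carries all but `ε / 2` of the sum.
  obtain ⟨σ, hσ⟩ := Equiv.Perm.exists_smul_eq_embedding (ι := s)
    ((Function.Embedding.subtype _).trans (Function.Embedding.subtype _))
    ((Function.Embedding.subtype _).trans g)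
  have hσg : ∀ i ∈ s, σ i = g i := fun i hi => DFunLike.congr_fun hσ (⟨i, hi⟩ : s)
  refine ⟨σ, ?_⟩
  let F : Function.support l → ℝ≥0∞ := fun i => if i ∈ s then 0 else L i
  have hF : ∑' i, F i < ε / 2 := by
    refine lt_of_eq_of_lt ?_ hs
    have : Function.support F ⊆ {i | i ∉ s} := fun i hi his => hi (if_pos his)
    rw [← tsum_subtype_eq_of_support_subset this]
    exact tsum_congr fun i => if_neg i.2
  -- The two families agree on `g '' s`. At any other `j`, both entries come from outside `s` or
  -- vanish, so the error is at most two copies of the tail `F`, transported by `σ` and by `g`.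
  have hbound : ∀ j, ENNReal.ofReal |l (σ.symm j) - m j| ≤
      Function.extend (fun i : Function.support l => σ i) F 0 j + Function.extend g F 0 j := by
    intro j
    have hinj : Function.Injective fun i : Function.support l => σ i :=
      σ.injective.comp Subtype.val_injective
    by_cases hj : ∃ i ∈ s, g i = j
    · obtain ⟨i, hi, rfl⟩ := hj
      rw [← hσg i hi, σ.symm_apply_apply, hσg i hi, hm, g.injective.extend_apply]
      simp
    · have h1 : ENNReal.ofReal |l (σ.symm j)| ≤
          Function.extend (fun i : Function.support l => σ i) F 0 j := by
        by_cases h0 : l (σ.symm j) = 0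
        · simp [h0]
        · have h2 := hinj.extend_apply F 0 ⟨σ.symm j, h0⟩
          simp only [σ.apply_symm_apply] at h2
          rw [h2]
          have h3 : (⟨σ.symm j, h0⟩ : Function.support l) ∉ s := fun hmem =>
            hj ⟨_, hmem, by rw [← hσg _ hmem]; exact σ.apply_symm_apply j⟩
          exact (if_neg h3).ge
      have h2 : ENNReal.ofReal |m j| ≤ Function.extend g F 0 j := by
        by_cases hr : ∃ i, g i = j
        · obtain ⟨i, rfl⟩ := hr
          rw [hm, g.injective.extend_apply, g.injective.extend_apply]
          exact (if_neg fun hi => hj ⟨i, hi, rfl⟩).ge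
        · rw [hm, Function.extend_apply' _ _ _ hr]
          simp
      refine le_trans ?_ (add_le_add h1 h2)
      rw [← ENNReal.ofReal_add (abs_nonneg _) (abs_nonneg _)]
      exact ENNReal.ofReal_le_ofReal (abs_sub _ _)
  calc _ ≤ ∑' j, (Function.extend (fun i : Function.support l => σ i) F 0 j +
        Function.extend g F 0 j) := ENNReal.tsum_le_tsum hbound
    _ = ∑' i, F i + ∑' i, F i := by
        rw [ENNReal.tsum_add, tsum_extend_zero (show Function.Injective fun i : Function.support l => σ i from
          σ.injective.comp Subtype.val_injective),
          tsum_extend_zero g.injective]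
    _ < ε / 2 + ε / 2 := ENNReal.add_lt_add hF hF
    _ = ε := ENNReal.add_halves ε

lemma tsum_abs_extend (l : ι → ℝ) (g : Function.support l ↪ ι) :
    ∑' j, ENNReal.ofReal |Function.extend g (fun i => l i) 0 j| ≤
      ∑' i, ENNReal.ofReal |l i| := by
  have h : (fun j => ENNReal.ofReal |Function.extend g (fun i => l i) 0 j|) =
      Function.extend g (fun i => ENNReal.ofReal |l i|) 0 := by
    funext j
    by_cases hj : ∃ i, g i = j
    · obtain ⟨i, rfl⟩ := hj
      rw [g.injective.extend_apply, g.injective.extend_apply]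
    · rw [Function.extend_apply' _ _ _ hj, Function.extend_apply' _ _ _ hj]
      simp
  rw [h, tsum_extend_zero g.injective]
  exact ENNReal.tsum_comp_le_tsum_of_injective Subtype.val_injective _

end Rearrangement

/-! ### Closedness of the orbit -/

section Orbit

variable {H : Type*} [NormedAddCommGroup H] [InnerProductSpace ℂ H] [CompleteSpace H]

lemma mem_of_isClosed {s : Set (TraceClass H)} (hs : IsClosed s) {A : TraceClass H}
    (h : ∀ ε : ℝ, 0 < ε → ∃ B ∈ s, traceNorm (B.op - A.op) < ENNReal.ofReal ε) : A ∈ s := by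
  by_contra hA
  obtain ⟨ε, hε, hball⟩ := hs.isOpen_compl A hA
  obtain ⟨B, hB, hlt⟩ := h ε hε
  exact hball B hlt hB

lemma isClosed_of_forall_mem {s : Set (TraceClass H)} (h : ∀ A : TraceClass H,
    (∀ ε : ℝ, 0 < ε → ∃ B ∈ s, traceNorm (B.op - A.op) < ENNReal.ofReal ε) → A ∈ s) :
    IsClosed s := by
  refine ⟨fun A hA => ?_⟩
  by_contra! hball
  refine hA (h A fun ε hε => ?_)
  obtain ⟨B, hlt, hB⟩ := hball ε hε
  exact ⟨B, not_not.1 hB, hlt⟩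

lemma mem_coadjointOrbit_iff {ρ A : TraceClass H} : A ∈ coadjointOrbit ρ ↔
    ∃ U : unitary (H →L[ℂ] H), (U : H →L[ℂ] H) * ρ.op * star (U : H →L[ℂ] H) = A.op :=
  exists_congr fun _ => TraceClass.ext_iff

lemma exists_ne_zero_apply_eq_zero_conj_iff (U : unitary (H →L[ℂ] H)) (T : H →L[ℂ] H) :
    (∃ x ≠ 0, ((U : H →L[ℂ] H) * T * star (U : H →L[ℂ] H)) x = 0) ↔ ∃ x ≠ 0, T x = 0 := by
  have key : ∀ (U : unitary (H →L[ℂ] H)) (T : H →L[ℂ] H), (∃ x ≠ 0, T x = 0) →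
      ∃ x ≠ 0, ((U : H →L[ℂ] H) * T * star (U : H →L[ℂ] H)) x = 0 := by
    rintro U T ⟨x, hx, hTx⟩
    refine ⟨(U : H →L[ℂ] H) x, fun h0 => hx ?_, ?_⟩
    · rw [← norm_eq_zero, ← Unitary.norm_map U x, h0, norm_zero]
    · rw [← mul_apply_eq_comp, mul_assoc, Unitary.star_mul_self_of_mem U.2, mul_one,
        mul_apply_eq_comp, hTx, map_zero]
  refine ⟨fun h => ?_, key U T⟩
  obtain ⟨x, hx, hTx⟩ := key (star U) _ h
  refine ⟨x, hx, ?_⟩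
  have h1 : star (U : H →L[ℂ] H) * (U : H →L[ℂ] H) = 1 := Unitary.star_mul_self_of_mem U.2
  have h2 : ((star U : unitary (H →L[ℂ] H)) : H →L[ℂ] H) *
      ((U : H →L[ℂ] H) * T * star (U : H →L[ℂ] H)) *
        star ((star U : unitary (H →L[ℂ] H)) : H →L[ℂ] H) = T := by
    rw [Unitary.coe_star, star_star]
    calc _ = (star (U : H →L[ℂ] H) * (U : H →L[ℂ] H)) * T *
          (star (U : H →L[ℂ] H) * (U : H →L[ℂ] H)) := by simp only [mul_assoc]
      _ = T := by rw [h1, one_mul, mul_one]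
  rwa [h2] at hTx

lemma isClosed_coadjointOrbit_of_isFiniteRank {ρ : TraceClass H} (hρ : IsSelfAdjoint ρ.op)
    (hfin : IsFiniteRank ρ.op) : IsClosed (coadjointOrbit ρ) := by
  classical
  obtain ⟨ι, b, l, hl⟩ := exists_hilbertBasis_apply_eq_smul hρ
    (isCompactOperator_of_traceNorm_lt_top hρ ρ.traceNorm_lt_top)
  have hsupp := (isFiniteRank_iff_of_diagonal hl).1 hfin
  -- The node `0` accounts for the basis vectors in the kernel.
  let s : Finset ℂ := insert 0 (hsupp.toFinset.image fun i => (l i : ℂ))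
  have hls : ∀ i, (l i : ℂ) ∈ s := by
    intro i
    by_cases hi : l i = 0
    · simp [s, hi]
    · exact Finset.mem_insert_of_mem (Finset.mem_image.2 ⟨i, hsupp.mem_toFinset.2 hi, rfl⟩)
  have hann : Polynomial.aeval ρ.op (Lagrange.nodal s id) = 0 := by
    refine clm_ext_hilbertBasis b fun i => ?_
    have h0 : (Lagrange.nodal s id).eval (l i : ℂ) = 0 :=
      Lagrange.eval_nodal_at_node (v := id) (hls i)
    rw [aeval_apply_of_apply_eq_smul (hl i), h0, zero_smul, zero_apply]
  refine isClosed_of_forall_mem fun A hA => ?_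
  rw [mem_coadjointOrbit_iff]
  refine exists_unitary_conj_of_forall_exists_norm_lt hρ hann fun ε hε => ?_
  obtain ⟨B, hB, hlt⟩ := hA ε hε
  obtain ⟨U, hU⟩ := mem_coadjointOrbit_iff.1 hB
  refine ⟨U, ?_⟩
  rw [hU]
  exact (ENNReal.ofReal_lt_ofReal_iff hε).1 ((ofReal_norm_le_traceNorm _).trans_lt hlt)

lemma isFiniteRank_of_isClosed_coadjointOrbit [TopologicalSpace.SeparableSpace H]
    {ρ : TraceClass H} (hρ : IsSelfAdjoint ρ.op) (hcl : IsClosed (coadjointOrbit ρ)) :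
    IsFiniteRank ρ.op := by
  obtain ⟨ι, b, l, hl⟩ := exists_hilbertBasis_apply_eq_smul hρ
    (isCompactOperator_of_traceNorm_lt_top hρ ρ.traceNorm_lt_top)
  have : Countable ι := countable_of_hilbertBasis b
  rw [isFiniteRank_iff_of_diagonal hl]
  by_contra hinf
  obtain ⟨g, hg⟩ := exists_embedding_surjective_iff hinf
  have hsum : ∑' i, ENNReal.ofReal |l i| < ∞ := traceNorm_of_diagonal hl ▸ ρ.traceNorm_lt_top
  -- The same nonzero eigenvalues with multiplicity, but with zeros exactly off the range of `g`.
  set m : ι → ℝ := Function.extend g (fun i => l i) 0 with hm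
  have hmsum : ∑' i, ENNReal.ofReal |m i| < ∞ := (tsum_abs_extend l g).trans_lt hsum
  obtain ⟨A, hA⟩ := exists_diagonal b hmsum.ne
  have hmem : (⟨A, (traceNorm_of_diagonal hA).trans_lt hmsum⟩ : TraceClass H) ∈
      coadjointOrbit ρ := by
    refine mem_of_isClosed hcl fun ε hε => ?_
    obtain ⟨σ, hσ⟩ := exists_perm_tsum_lt l hsum.ne g (ENNReal.ofReal_pos.2 hε)
    obtain ⟨U, hU⟩ := exists_unitary_apply_eq b σ
    refine ⟨U • ρ, ⟨U, rfl⟩, lt_of_eq_of_lt (traceNorm_of_diagonal (b := b) fun j => ?_) hσ⟩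
    change ((U : H →L[ℂ] H) * ρ.op * star (U : H →L[ℂ] H)) (b j) - A (b j) = _
    rw [conj_diagonal hl hU, hA, ← sub_smul, Complex.ofReal_sub]
  obtain ⟨U, hU⟩ := mem_coadjointOrbit_iff.1 hmem
  have h1 := exists_ne_zero_apply_eq_zero_conj_iff U ρ.op
  rw [hU] at h1
  have h2 : (∃ i, m i = 0) ↔ ∃ i, l i = 0 :=
    (exists_ne_zero_apply_eq_zero_iff hA).symm.trans (h1.trans (exists_ne_zero_apply_eq_zero_iff hl))
  have h3 : (∃ i, m i = 0) ↔ ¬ Function.Surjective g := by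
    constructor
    · rintro ⟨j, hj⟩ hsurj
      obtain ⟨i, rfl⟩ := hsurj j
      rw [hm, g.injective.extend_apply] at hj
      exact i.2 hj
    · intro hsurj
      obtain ⟨j, hj⟩ := not_forall.1 hsurj
      exact ⟨j, Function.extend_apply' _ _ _ hj⟩
  have h4 : (∃ i, l i = 0) ↔ Function.support l ≠ Set.univ := by
    simp [Set.ne_univ_iff_exists_notMem]
  -- By the choice of `g`, equivalence of "`m` has a zero" and "`l` has a zero" makes surjectivity
  -- of `g` equivalent to its negation.
  have h5 := h3.symm.trans (h2.trans (h4.trans hg.symm))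
  exact not_iff_self h5

end Orbit

end CoadjointOrbit

theorem mainTheorem1 {H : Type*} [NormedAddCommGroup H] [InnerProductSpace ℂ H]
    [CompleteSpace H] [TopologicalSpace.SeparableSpace H]
    (ρ : CoadjointOrbit.TraceClass H) (hρ : IsSelfAdjoint ρ.op) :
    IsClosed (CoadjointOrbit.coadjointOrbit ρ) ↔ CoadjointOrbit.IsFiniteRank ρ.op :=
  ⟨CoadjointOrbit.isFiniteRank_of_isClosed_coadjointOrbit hρ,
    CoadjointOrbit.isClosed_coadjointOrbit_of_isFiniteRank hρ⟩
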